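/- For $\alpha>-1$ and $n\ge 0$ let $$L_n^{(\alpha)}(x)=\sum_{k=0}^{n}(-1)^k\binom{n+\alpha}{n-k}\frac{x^k}{k!}$$ be the Laguerre polynomials. Let $\lambda>0$ and consider the Sobolev inner product $$\langle u,v\rangle_\lambda=\lambda\int_0^{\infty}u(x)v(x)\frac{1}{x}\,dx+\int_0^{\infty}u'(x)v'(x)\,dx .$$ Let $S_n$ ($n\ge 0$) be the polynomials such that the functions $S_n(x)\,x\,e^{-x/2}$ are obtained by applying the Gram–Schmidt process with respect to $\langle\cdot,\cdot\rangle_\lambda$ to the functions $x^k\,x\,e^{-x/2}$, $k=0,1,2,\dots$, where $S_n$ is normalized to have the same leading coefficient $(-1)^n/n!$ as $L_n^{(1)}$. Then there is exactly one sequence $(a_n)_{n\ge 0}$ of real numbers such that $$L_n^{(1)}(x)=S_n(x)+a_{n-1}S_{n-1}(x)\qquad (n\ge 1).$$ For every $n\ge 0$ one has $L_{n+1}^{(1)}(-4\lambda)\neq 0$ and $$a_n=\frac{n+2}{n+1}\,\frac{L_n^{(1)}(-4\lambda)}{L_{n+1}^{(1)}(-4\lambda)},$$ and, for fixed $\lambda$,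 $$a_n=1-\frac{\sqrt{4\lambda}}{\sqrt n}+O\!\left(\frac1n\right)\qquad (n\to\infty).$$ -/

import Mathlib

open Polynomial Asymptotics Filter MeasureTheory

noncomputable section

namespace LaguerreSobolev

/-- The Laguerre polynomial
`L_n^{(α)}(x) = ∑_{k=0}^n (-1)^k binom(n + α, n - k) x^k / k!`, where the binomial coefficient with
real upper entry is `Ring.choose`. -/
def laguerre (α : ℝ) (n : ℕ) : ℝ[X] :=
  ∑ k ∈ Finset.range (n + 1),
    C ((-1 : ℝ) ^ k * Ring.choose ((n : ℝ) + α) (n - k) / (k.factorial : ℝ)) * X ^ k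

/-- The Sobolev inner product
`⟨u, v⟩_lam = lam ∫_0^∞ u(x) v(x) / x dx + ∫_0^∞ u'(x) v'(x) dx`. -/
def sobolevInner (lam : ℝ) (u v : ℝ → ℝ) : ℝ :=
  lam * (∫ x in Set.Ioi (0 : ℝ), u x * v x * (1 / x)) +
    ∫ x in Set.Ioi (0 : ℝ), deriv u x * deriv v x

/-- The test function `p(x) x e^{-x/2}` attached to a polynomial `p`. -/
def testFun (p : ℝ[X]) (x : ℝ) : ℝ :=
  p.eval x * x * Real.exp (-x / 2)

/-- The bilinear form `⟨p(x) x e^{-x/2}, q(x) x e^{-x/2}⟩_lam` on polynomials. -/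
def polyInner (lam : ℝ) (p q : ℝ[X]) : ℝ :=
  sobolevInner lam (testFun p) (testFun q)

/-- The monic polynomials `P_n` for which `P_n(x) x e^{-x/2}` results from the (unnormalised)
Gram-Schmidt process applied to `x^k x e^{-x/2}`, `k = 0, 1, …`, with respect to `⟨·, ·⟩_lam`. -/
def gramSchmidtPoly (lam : ℝ) (n : ℕ) : ℝ[X] :=
  X ^ n - ∑ k : Fin n,
    C (polyInner lam (X ^ n) (gramSchmidtPoly lam k) /
        polyInner lam (gramSchmidtPoly lam k) (gramSchmidtPoly lam k)) *
      gramSchmidtPoly lam k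
termination_by n
decreasing_by all_goals exact k.isLt

/-- The Laguerre-Sobolev orthogonal polynomial `S_n`, scaled to have the leading coefficient
`(-1)^n / n!` of the Laguerre polynomial `L_n^{(1)}`. -/
def sobolevPoly (lam : ℝ) (n : ℕ) : ℝ[X] :=
  C ((-1 : ℝ) ^ n / (n.factorial : ℝ)) * gramSchmidtPoly lam n

/-- `a` is a sequence of coefficients in the connection formula
`L_n^{(1)} = S_n + a_{n-1} S_{n-1}`, `n ≥ 1` (written here with `n + 1` in place of `n`). -/
def IsConnectionSeq (lam : ℝ) (a : ℕ → ℝ) : Prop :=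
  ∀ n : ℕ, laguerre 1 (n + 1) = sobolevPoly lam (n + 1) + C (a n) * sobolevPoly lam n

end LaguerreSobolev

end

/-! The half-exponentials combine to the weight `e^{-x}`, so the Sobolev form becomes an algebraic
bilinear form `polyForm` on polynomials. Integrating by parts and using the Laguerre equation turns
the derivative term into multiplication by `n + 1 - x/4` on `laguerre 1 n`; with the three-term
recurrence, the Gram matrix of the Laguerre polynomials is tridiagonal (`polyForm_laguerre_self`,
`polyForm_laguerre_succ`, `polyForm_laguerre_of_lt`). Orthogonalising such a basis subtracts only a
multiple of the preceding vector. The pivots obey a Riccati recursion, which is linearised by the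
Laguerre recurrence at `-4 * lam`; this gives the closed form of the coefficients. For the
asymptotics, put `y n = L_{n+1}/L_n - 1` at `-4 * lam`. Then `y (n+1) = 4 lam/(n+2) + y n/(1 + y
n)`, whose approximate equilibrium is `√(4 lam/(n+2))`. The map is contracting there, which keeps
the error `O(1/n)`. -/

noncomputable section

namespace LaguerreSobolev

/-! ### Reduction of the Sobolev form to moments. -/

/-- The moment functional `p ↦ ∫_0^∞ p(x) e^{-x} dx`, given by `x^k ↦ k!`. -/
def expMoment : ℝ[X] →ₗ[ℝ] ℝ :=
  Polynomial.lsum fun k => (k.factorial : ℝ) • LinearMap.id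

lemma expMoment_monomial (k : ℕ) (c : ℝ) : expMoment (monomial k c) = k.factorial * c := by
  simp [expMoment]

lemma expMoment_derivative (p : ℝ[X]) :
    expMoment (derivative p) = expMoment p - p.eval 0 := by
  induction p using Polynomial.induction_on' with
  | add p q hp hq => simp only [map_add, hp, hq, eval_add]; ring
  | monomial k c =>
    rw [derivative_monomial, expMoment_monomial, expMoment_monomial, eval_monomial]
    rcases k with _ | k
    · simp
    · simp [Nat.factorial_succ]; ring

lemma integrableOn_pow_mul_exp_neg (k : ℕ) :
    IntegrableOn (fun x : ℝ => x ^ k * Real.exp (-x)) (Set.Ioi 0) := by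
  have h := Real.GammaIntegral_convergent (s := (k : ℝ) + 1) (by positivity)
  refine h.congr_fun (fun x _ => ?_) measurableSet_Ioi
  simp [mul_comm]

lemma integral_pow_mul_exp_neg (k : ℕ) :
    ∫ x in Set.Ioi (0 : ℝ), x ^ k * Real.exp (-x) = k.factorial := by
  rw [← Real.Gamma_nat_eq_factorial, Real.Gamma_eq_integral (by positivity)]
  refine setIntegral_congr_fun measurableSet_Ioi fun x _ => ?_
  simp [mul_comm]

lemma integrableOn_eval_mul_exp_neg (p : ℝ[X]) :
    IntegrableOn (fun x : ℝ => p.eval x * Real.exp (-x)) (Set.Ioi 0) := by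
  induction p using Polynomial.induction_on' with
  | add p q hp hq =>
    simp only [eval_add, add_mul]
    exact Integrable.add hp hq
  | monomial k c =>
    simp only [eval_monomial, mul_assoc]
    exact Integrable.const_mul (integrableOn_pow_mul_exp_neg k) c

lemma integral_eval_mul_exp_neg (p : ℝ[X]) :
    ∫ x in Set.Ioi (0 : ℝ), p.eval x * Real.exp (-x) = expMoment p := by
  induction p using Polynomial.induction_on' with
  | add p q hp hq =>
    simp only [eval_add, add_mul, map_add]
    rw [integral_add (integrableOn_eval_mul_exp_neg p) (integrableOn_eval_mul_exp_neg q), hp, hq]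
  | monomial k c =>
    simp only [eval_monomial, mul_assoc]
    rw [integral_const_mul, integral_pow_mul_exp_neg, expMoment_monomial, mul_comm]

/-- The operator `q ↦ q' - q / 2`, so that `(q e^{-x/2})' = (q' - q / 2) e^{-x/2}`. -/
def dampedDeriv : ℝ[X] →ₗ[ℝ] ℝ[X] :=
  derivative - (1 / 2 : ℝ) • LinearMap.id

lemma dampedDeriv_apply (q : ℝ[X]) : dampedDeriv q = derivative q - (1 / 2 : ℝ) • q := rfl

lemma deriv_testFun (p : ℝ[X]) (x : ℝ) :
    deriv (testFun p) x = (dampedDeriv (X * p)).eval x * Real.exp (-x / 2) := by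
  have h1 : HasDerivAt (fun x : ℝ => (X * p).eval x) ((derivative (X * p)).eval x) x :=
    (X * p).hasDerivAt x
  have h2 : HasDerivAt (fun x : ℝ => Real.exp (-x / 2)) (Real.exp (-x / 2) * (-1 / 2)) x :=
    ((hasDerivAt_neg x).div_const 2).exp
  have h : testFun p = fun x => (X * p).eval x * Real.exp (-x / 2) := by
    funext y; simp [testFun, mul_comm]
  rw [h, HasDerivAt.deriv (h1.fun_mul h2), dampedDeriv_apply]
  simp only [eval_sub, eval_smul, smul_eq_mul]
  ring

lemma exp_half_mul_self (x : ℝ) : Real.exp (-x / 2) * Real.exp (-x / 2) = Real.exp (-x) := by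
  rw [← Real.exp_add]; congr 1; ring

/-- The form `polyInner` expressed through the moment functional. -/
def polyForm (lam : ℝ) : LinearMap.BilinForm ℝ ℝ[X] :=
  LinearMap.mk₂ ℝ
    (fun p q => lam * expMoment (X * p * q) +
      expMoment (dampedDeriv (X * p) * dampedDeriv (X * q)))
    (fun p p' q => by simp only [mul_add, add_mul, map_add]; ring)
    (fun c p q => by
      simp only [mul_smul_comm, smul_mul_assoc, map_smul, smul_eq_mul]; ring)
    (fun p q q' => by simp only [mul_add, map_add]; ring)
    (fun c p q => by
      simp only [mul_smul_comm, map_smul, smul_eq_mul]; ring)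

lemma polyForm_apply (lam : ℝ) (p q : ℝ[X]) :
    polyForm lam p q = lam * expMoment (X * p * q) +
      expMoment (dampedDeriv (X * p) * dampedDeriv (X * q)) := rfl

lemma polyForm_comm (lam : ℝ) (p q : ℝ[X]) : polyForm lam p q = polyForm lam q p := by
  rw [polyForm_apply, polyForm_apply, mul_right_comm, mul_comm (dampedDeriv _)]

lemma polyInner_eq_polyForm (lam : ℝ) (p q : ℝ[X]) : polyInner lam p q = polyForm lam p q := by
  rw [polyInner, sobolevInner, polyForm_apply, ← integral_eval_mul_exp_neg,
    ← integral_eval_mul_exp_neg]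
  congr 2
  · refine setIntegral_congr_fun measurableSet_Ioi fun x hx => ?_
    have hx0 : x ≠ 0 := ne_of_gt hx
    simp only [testFun, eval_mul, eval_X, ← exp_half_mul_self x]
    field_simp
  · funext x
    rw [deriv_testFun, deriv_testFun, eval_mul, ← exp_half_mul_self x]
    ring

/-- Integration by parts: `q ↦ q' - q / 2` is skew up to a boundary term at `0`. -/
lemma expMoment_dampedDeriv_mul (a b : ℝ[X]) :
    expMoment (dampedDeriv a * b) = -expMoment (a * dampedDeriv b) - a.eval 0 * b.eval 0 := by
  have h := expMoment_derivative (a * b)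
  have e : dampedDeriv a * b + a * dampedDeriv b = derivative (a * b) - a * b := by
    simp only [dampedDeriv_apply, derivative_mul, smul_eq_C_mul]
    have : (C (1 / 2 : ℝ) : ℝ[X]) + C (1 / 2) = 1 := by rw [← C_add]; norm_num
    linear_combination (- a * b) * this
  have h2 := congrArg expMoment e
  rw [map_add, map_sub, h, eval_mul] at h2
  linarith

/-- The boundary term of the integration by parts vanishes because `X * p` is zero at `0`. -/
lemma polyForm_eq (lam : ℝ) (p q : ℝ[X]) :
    polyForm lam p q = lam * expMoment (X * p * q) -
      expMoment (X * p * dampedDeriv (dampedDeriv (X * q))) := by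
  rw [polyForm_apply, expMoment_dampedDeriv_mul]
  simp
  ring

/-! ### Differential equation and recurrence of the Laguerre polynomials. -/

lemma laguerre_one_coeff (n k : ℕ) :
    (laguerre 1 n).coeff k = (-1) ^ k * (n + 1).choose (k + 1) / k.factorial := by
  have hc : ∀ j, Ring.choose ((n : ℝ) + 1) j = ((n + 1).choose j : ℝ) := fun j => by
    rw [← Nat.cast_add_one, Ring.choose_natCast]
  rw [laguerre, finsetSum_coeff]
  simp only [coeff_C_mul_X_pow, hc]
  rw [Finset.sum_ite_eq]
  split_ifs with h
  · have hk : k ≤ n := by simpa [Nat.lt_succ_iff] using h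
    rw [Nat.choose_symm_of_eq_add (show n + 1 = (n - k) + (k + 1) by omega)]
  · have hk : n < k := by simpa [Nat.lt_succ_iff] using h
    rw [Nat.choose_eq_zero_of_lt (by omega)]
    simp

lemma laguerre_one_ode (n : ℕ) :
    X * derivative (derivative (laguerre 1 n)) + (2 - X) * derivative (laguerre 1 n) +
      (n : ℝ[X]) * laguerre 1 n = 0 := by
  ext k
  have key : ((k : ℝ) + 1) * (k + 2) * (laguerre 1 n).coeff (k + 1) =
      (k - n) * (laguerre 1 n).coeff k := by
    have h : ((n + 1).choose (k + 2) : ℝ) * (k + 2) = (n + 1).choose (k + 1) * (n - k) := by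
      rcases le_or_gt k n with hk | hk
      · have := Nat.choose_succ_right_eq (n + 1) (k + 1)
        rw [show n + 1 - (k + 1) = n - k by omega] at this
        have := congrArg (Nat.cast (R := ℝ)) this
        push_cast [Nat.cast_sub hk] at this
        linear_combination this
      · rw [Nat.choose_eq_zero_of_lt (by omega), Nat.choose_eq_zero_of_lt (by omega)]
        simp
    rw [laguerre_one_coeff, laguerre_one_coeff, Nat.factorial_succ]
    have : (k.factorial : ℝ) ≠ 0 := by positivity
    push_cast
    field_simp
    rw [pow_succ]
    linear_combination (-1 : ℝ) ^ k * (-1) * h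
  have e : (2 - X) * derivative (laguerre 1 n) =
      C 2 * derivative (laguerre 1 n) - X * derivative (laguerre 1 n) := by
    rw [sub_mul]; rfl
  rw [e, ← C_eq_natCast]
  rcases k with _ | k
  · simp only [coeff_add, coeff_sub, coeff_X_mul_zero, coeff_C_mul, coeff_derivative, coeff_zero]
    push_cast at key ⊢
    linear_combination key
  · simp only [coeff_add, coeff_sub, coeff_X_mul, coeff_C_mul, coeff_derivative, coeff_zero]
    push_cast at key ⊢
    linear_combination key

lemma laguerre_one_zero : laguerre 1 0 = 1 := by
  simp [laguerre]

lemma laguerre_one_one : laguerre 1 1 = 2 - X := by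
  ext k
  rw [laguerre_one_coeff]
  rcases k with _ | _ | k
  · simp [← C_ofNat]
  · simp [coeff_X, ← C_ofNat]
  · rw [Nat.choose_eq_zero_of_lt (by omega)]
    simp [coeff_X, ← C_ofNat]

lemma laguerre_one_recurrence (n : ℕ) :
    (n + 2 : ℝ) • laguerre 1 (n + 2) =
      (2 * n + 4 : ℝ) • laguerre 1 (n + 1) - X * laguerre 1 (n + 1) -
        (n + 2 : ℝ) • laguerre 1 n := by
  ext k
  rcases k with _ | k
  · simp only [coeff_sub, coeff_smul, coeff_X_mul_zero, laguerre_one_coeff, smul_eq_mul]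
    simp
    ring
  · simp only [coeff_sub, coeff_smul, coeff_X_mul, laguerre_one_coeff, smul_eq_mul]
    have h1 : ((n + 2 + 1).choose (k + 1 + 1) : ℝ) =
        (n + 1 + 1).choose (k + 1) + (n + 1 + 1).choose (k + 1 + 1) := by
      exact_mod_cast Nat.choose_succ_succ (n + 2) (k + 1)
    have h2 : ((n + 1 + 1).choose (k + 1 + 1) : ℝ) =
        (n + 1).choose (k + 1) + (n + 1).choose (k + 2) := by
      exact_mod_cast Nat.choose_succ_succ (n + 1) (k + 1)
    have h3 : ((n + 1 + 1).choose (k + 1) : ℝ) =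
        (n + 1).choose k + (n + 1).choose (k + 1) := by
      exact_mod_cast Nat.choose_succ_succ (n + 1) k
    have h4 : ((n : ℝ) + 2) * (n + 1).choose k = (n + 1 + 1).choose (k + 1) * (k + 1) := by
      exact_mod_cast Nat.add_one_mul_choose_eq (n + 1) k
    rw [h3] at h4
    rw [h1, h2, h3, Nat.factorial_succ]
    have : (k.factorial : ℝ) ≠ 0 := by positivity
    push_cast
    field_simp
    rw [pow_succ]
    linear_combination (-(-1 : ℝ) ^ k) * h4

/-! ### The tridiagonal Gram matrix. -/

lemma dampedDeriv_dampedDeriv_laguerre (n : ℕ) :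
    dampedDeriv (dampedDeriv (X * laguerre 1 n)) =
      (1 / 4 : ℝ) • (X * laguerre 1 n) - (n + 1 : ℝ) • laguerre 1 n := by
  have h2 : (C (1 / 2 : ℝ) : ℝ[X]) + C (1 / 2) = 1 := by rw [← C_add]; norm_num
  have h4 : (C (1 / 4 : ℝ) : ℝ[X]) = C (1 / 2) * C (1 / 2) := by rw [← C_mul]; norm_num
  simp only [dampedDeriv_apply, smul_eq_C_mul, derivative_sub, derivative_mul, derivative_X,
    derivative_one, derivative_C, C_add, C_1, C_eq_natCast, h4, derivative_add]
  linear_combination laguerre_one_ode n -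
    (laguerre 1 n + X * derivative (laguerre 1 n)) * h2

lemma polyForm_laguerre (lam : ℝ) (p : ℝ[X]) (n : ℕ) :
    polyForm lam p (laguerre 1 n) = (lam + n + 1) * expMoment (X * p * laguerre 1 n) -
      1 / 4 * expMoment (X * p * (X * laguerre 1 n)) := by
  rw [polyForm_eq, dampedDeriv_dampedDeriv_laguerre, mul_sub, mul_smul_comm, mul_smul_comm,
    map_sub, map_smul, map_smul, smul_eq_mul, smul_eq_mul]
  ring

/-- Sturm–Liouville argument: the form is symmetric, but exchanging `m` and `n` in
`polyForm_laguerre` changes the eigenvalue, so `n - m` times the moment is zero. -/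
lemma expMoment_laguerre_of_ne {m n : ℕ} (h : m ≠ n) :
    expMoment (X * laguerre 1 m * laguerre 1 n) = 0 := by
  have hs := polyForm_comm 0 (laguerre 1 m) (laguerre 1 n)
  rw [polyForm_laguerre, polyForm_laguerre, mul_right_comm X (laguerre 1 n),
    show X * laguerre 1 n * (X * laguerre 1 m) = X * laguerre 1 m * (X * laguerre 1 n) by ring]
    at hs
  have h0 : ((n : ℝ) - m) ≠ 0 := sub_ne_zero.2 (by exact_mod_cast h.symm)
  apply mul_left_cancel₀ h0
  linear_combination hs

/-- Since `n ≤ m`, the lower neighbour of `laguerre 1 n` in the recurrence is orthogonal to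
`laguerre 1 m` and drops out. -/
lemma expMoment_X_mul_laguerre {m n : ℕ} (h : n ≤ m) :
    expMoment (X * laguerre 1 m * (X * laguerre 1 n)) =
      (2 * n + 2) * expMoment (X * laguerre 1 m * laguerre 1 n) -
        (n + 1) * expMoment (X * laguerre 1 m * laguerre 1 (n + 1)) := by
  rcases n with _ | n
  · have e : X * laguerre 1 0 = (2 : ℝ) • laguerre 1 0 - laguerre 1 1 := by
      rw [laguerre_one_zero, laguerre_one_one, smul_eq_C_mul, C_ofNat]; ring
    rw [e, mul_sub, mul_smul_comm, map_sub, map_smul, smul_eq_mul]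
    simp
  · have e : X * laguerre 1 (n + 1) = (2 * n + 4 : ℝ) • laguerre 1 (n + 1) -
        (n + 2 : ℝ) • laguerre 1 n - (n + 2 : ℝ) • laguerre 1 (n + 2) := by
      rw [laguerre_one_recurrence]; abel
    rw [e, mul_sub, mul_sub, mul_smul_comm, mul_smul_comm, mul_smul_comm, map_sub, map_sub,
      map_smul, map_smul, map_smul, smul_eq_mul, smul_eq_mul, smul_eq_mul,
      expMoment_laguerre_of_ne (show m ≠ n by omega)]
    push_cast
    ring

lemma expMoment_laguerre_self (n : ℕ) :
    expMoment (X * laguerre 1 n * laguerre 1 n) = n + 1 := by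
  induction n with
  | zero =>
    rw [laguerre_one_zero, mul_one, mul_one, X, expMoment_monomial]
    simp
  | succ n ih =>
    -- Expanding the mixed moment of `X * L_n` and `X * L_{n+1}` by the recurrence on either factor
    -- gives `(n+1) h_{n+1} = (n+2) h_n` for the squared norms `h`.
    have h1 := expMoment_X_mul_laguerre (Nat.le_succ n)
    have e : X * laguerre 1 (n + 1) = (2 * n + 4 : ℝ) • laguerre 1 (n + 1) -
        (n + 2 : ℝ) • laguerre 1 n - (n + 2 : ℝ) • laguerre 1 (n + 2) := by
      rw [laguerre_one_recurrence]; abel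
    rw [Nat.succ_eq_add_one, show X * laguerre 1 (n + 1) * (X * laguerre 1 n) =
      X * laguerre 1 n * (X * laguerre 1 (n + 1)) by ring] at h1
    rw [e, mul_sub, mul_sub, mul_smul_comm, mul_smul_comm, mul_smul_comm, map_sub, map_sub,
      map_smul, map_smul, map_smul, ← e, smul_eq_mul, smul_eq_mul, smul_eq_mul,
      expMoment_laguerre_of_ne (show n ≠ n + 1 by omega),
      expMoment_laguerre_of_ne (show n ≠ n + 2 by omega),
      expMoment_laguerre_of_ne (show n + 1 ≠ n by omega), ih] at h1
    have h0 : (n : ℝ) + 1 ≠ 0 := by positivity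
    apply mul_left_cancel₀ h0
    push_cast
    linear_combination h1

lemma polyForm_laguerre_self (lam : ℝ) (n : ℕ) :
    polyForm lam (laguerre 1 n) (laguerre 1 n) = (n + 1) * (lam + (n + 1) / 2) := by
  rw [polyForm_laguerre, expMoment_X_mul_laguerre le_rfl, expMoment_laguerre_self,
    expMoment_laguerre_of_ne (Nat.succ_ne_self n).symm]
  ring

lemma polyForm_laguerre_succ (lam : ℝ) (n : ℕ) :
    polyForm lam (laguerre 1 (n + 1)) (laguerre 1 n) = (n + 1) * (n + 2) / 4 := by
  rw [polyForm_laguerre, expMoment_X_mul_laguerre (Nat.le_succ n), expMoment_laguerre_self,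
    expMoment_laguerre_of_ne (Nat.succ_ne_self n)]
  push_cast
  ring

lemma polyForm_laguerre_of_lt (lam : ℝ) {m n : ℕ} (h : n + 1 < m) :
    polyForm lam (laguerre 1 m) (laguerre 1 n) = 0 := by
  rw [polyForm_laguerre, expMoment_X_mul_laguerre (by omega),
    expMoment_laguerre_of_ne (show m ≠ n by omega),
    expMoment_laguerre_of_ne (show m ≠ n + 1 by omega)]
  ring

/-! ### Positivity, connection coefficients and orthogonality. -/

lemma laguerre_one_eval_neg_pos (n : ℕ) {t : ℝ} (ht : 0 ≤ t) :
    0 < (laguerre 1 n).eval (-t) := by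
  have hd : (laguerre 1 n).natDegree < n + 1 := by
    rw [Nat.lt_succ_iff, natDegree_le_iff_coeff_eq_zero]
    intro k hk
    rw [laguerre_one_coeff, Nat.choose_eq_zero_of_lt (by omega)]
    simp
  have e : ∀ k, (laguerre 1 n).coeff k * (-t) ^ k =
      (n + 1).choose (k + 1) / k.factorial * t ^ k := fun k => by
    rw [laguerre_one_coeff, neg_pow t,
      show ∀ a b c d : ℝ, a * b / c * (a * d) = a * a * (b / c * d) by intros; ring,
      ← mul_pow]
    simp
  rw [eval_eq_sum_range' hd]
  simp only [e]
  refine Finset.sum_pos' (fun k _ => by positivity) ⟨0, by simp, ?_⟩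
  simp
  positivity

/-- The connection coefficients between the Laguerre and the Laguerre-Sobolev polynomials. -/
def connCoeff (lam : ℝ) (n : ℕ) : ℝ :=
  ((n : ℝ) + 2) / (n + 1) *
    ((laguerre 1 n).eval (-4 * lam) / (laguerre 1 (n + 1)).eval (-4 * lam))

/-- The polynomials obtained from the Laguerre polynomials through `connCoeff`. -/
def connPoly (lam : ℝ) : ℕ → ℝ[X]
  | 0 => laguerre 1 0
  | n + 1 => laguerre 1 (n + 1) - connCoeff lam n • connPoly lam n

/-- The squared norm of `connPoly lam n` for the form `polyForm lam`. -/
def connNorm (lam : ℝ) (n : ℕ) : ℝ :=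
  ((n : ℝ) + 1) ^ 2 / 4 *
    ((laguerre 1 (n + 1)).eval (-4 * lam) / (laguerre 1 n).eval (-4 * lam))

lemma laguerre_one_eval_pos (n : ℕ) {lam : ℝ} (hlam : 0 < lam) :
    0 < (laguerre 1 n).eval (-4 * lam) := by
  rw [neg_mul]
  exact laguerre_one_eval_neg_pos n (by positivity)

lemma connNorm_pos {lam : ℝ} (hlam : 0 < lam) (n : ℕ) : 0 < connNorm lam n := by
  have h1 := laguerre_one_eval_pos n hlam
  have h2 := laguerre_one_eval_pos (n + 1) hlam
  unfold connNorm
  positivity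

lemma laguerre_one_eval_recurrence (n : ℕ) (x : ℝ) :
    (n + 2) * (laguerre 1 (n + 2)).eval x =
      (2 * n + 4 - x) * (laguerre 1 (n + 1)).eval x - (n + 2) * (laguerre 1 n).eval x := by
  have := congrArg (eval x) (laguerre_one_recurrence n)
  simp only [eval_smul, eval_sub, eval_mul, eval_X, smul_eq_mul] at this
  linear_combination this

lemma connCoeff_mul_connNorm {lam : ℝ} (hlam : 0 < lam) (n : ℕ) :
    connCoeff lam n * connNorm lam n = (n + 1) * (n + 2) / 4 := by
  have h1 := (laguerre_one_eval_pos n hlam).ne'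
  have h2 := (laguerre_one_eval_pos (n + 1) hlam).ne'
  unfold connCoeff connNorm
  generalize eval (-4 * lam) (laguerre 1 n) = u at *
  generalize eval (-4 * lam) (laguerre 1 (n + 1)) = v at *
  field_simp

lemma connNorm_zero (lam : ℝ) : connNorm lam 0 = lam + 1 / 2 := by
  simp only [connNorm, zero_add, laguerre_one_zero, laguerre_one_one, eval_sub, eval_X, eval_one,
    eval_ofNat]
  push_cast
  ring

/-- With `connCoeff_mul_connNorm`, these are the elimination equations of the tridiagonal matrix;
this one is the Laguerre recurrence at `-4 * lam` divided by `L_{n+1}`. -/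
lemma connNorm_succ {lam : ℝ} (hlam : 0 < lam) (n : ℕ) :
    connNorm lam (n + 1) =
      (n + 2) * (lam + (n + 2) / 2) - connCoeff lam n * ((n + 1) * (n + 2) / 4) := by
  have h1 := (laguerre_one_eval_pos n hlam).ne'
  have h2 := (laguerre_one_eval_pos (n + 1) hlam).ne'
  have h := laguerre_one_eval_recurrence n (-4 * lam)
  unfold connCoeff connNorm
  generalize eval (-4 * lam) (laguerre 1 n) = u at *
  generalize eval (-4 * lam) (laguerre 1 (n + 1)) = v at *
  rw [show n + 1 + 1 = n + 2 from rfl]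
  generalize eval (-4 * lam) (laguerre 1 (n + 2)) = w at *
  push_cast
  field_simp
  linear_combination 2 * (n + 2 : ℝ) * h

/-- The values at indices above `n` are included because the induction step needs them for the next
diagonal and off-diagonal entries. -/
lemma polyForm_connPoly_laguerre {lam : ℝ} (hlam : 0 < lam) (n : ℕ) :
    (∀ m, m < n → polyForm lam (connPoly lam n) (laguerre 1 m) = 0) ∧
    polyForm lam (connPoly lam n) (laguerre 1 n) = connNorm lam n ∧
    polyForm lam (connPoly lam n) (laguerre 1 (n + 1)) = (n + 1) * (n + 2) / 4 ∧
    ∀ m, n + 1 < m → polyForm lam (connPoly lam n) (laguerre 1 m) = 0 := by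
  induction n with
  | zero =>
    refine ⟨by simp, ?_, ?_, fun m hm => ?_⟩
    · rw [connPoly, polyForm_laguerre_self, connNorm_zero]; simp
    · rw [connPoly, polyForm_comm, polyForm_laguerre_succ]
    · rw [connPoly, polyForm_comm, polyForm_laguerre_of_lt lam hm]
  | succ n ih =>
    obtain ⟨h1, h2, h3, h4⟩ := ih
    have e : ∀ q, polyForm lam (connPoly lam (n + 1)) q =
        polyForm lam (laguerre 1 (n + 1)) q - connCoeff lam n * polyForm lam (connPoly lam n) q := by
      intro q
      rw [connPoly, map_sub, map_smul, LinearMap.sub_apply, LinearMap.smul_apply, smul_eq_mul]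
    refine ⟨fun m hm => ?_, ?_, ?_, fun m hm => ?_⟩
    · rw [e]
      rcases (Nat.lt_succ_iff.1 hm).lt_or_eq with hm | rfl
      · rw [h1 m hm, polyForm_laguerre_of_lt lam (by omega)]; ring
      · rw [h2, polyForm_laguerre_succ, connCoeff_mul_connNorm hlam]; ring
    · rw [e, h3, polyForm_laguerre_self, connNorm_succ hlam]; push_cast; ring
    · rw [e, h4 _ (by omega), polyForm_comm, polyForm_laguerre_succ]; ring
    · rw [e, h4 m (by omega), polyForm_comm, polyForm_laguerre_of_lt lam hm]; ring

lemma polyForm_connPoly_of_lt {lam : ℝ} (hlam : 0 < lam) {m n : ℕ} (h : m < n) :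
    polyForm lam (connPoly lam n) (connPoly lam m) = 0 := by
  induction m with
  | zero => exact (polyForm_connPoly_laguerre hlam n).1 0 h
  | succ m ih =>
    rw [connPoly, map_sub, map_smul, ih (by omega), (polyForm_connPoly_laguerre hlam n).1 _ h]
    simp

lemma polyForm_connPoly_self {lam : ℝ} (hlam : 0 < lam) (n : ℕ) :
    polyForm lam (connPoly lam n) (connPoly lam n) = connNorm lam n := by
  rcases n with _ | n
  · exact (polyForm_connPoly_laguerre hlam 0).2.1
  · conv_lhs => rw [show polyForm lam (connPoly lam (n + 1)) (connPoly lam (n + 1)) =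
      polyForm lam (connPoly lam (n + 1)) (laguerre 1 (n + 1) - connCoeff lam n • connPoly lam n)
      from rfl]
    rw [map_sub, map_smul, polyForm_connPoly_of_lt hlam (Nat.lt_succ_self n),
      (polyForm_connPoly_laguerre hlam (n + 1)).2.1]
    simp

lemma connPoly_coeff (lam : ℝ) (n : ℕ) :
    (connPoly lam n).coeff n = (-1) ^ n / n.factorial ∧
      ∀ k, n < k → (connPoly lam n).coeff k = 0 := by
  induction n with
  | zero =>
    refine ⟨by simp [connPoly, laguerre_one_coeff], fun k hk => ?_⟩
    rw [connPoly, laguerre_one_coeff, Nat.choose_eq_zero_of_lt (by omega)]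
    simp
  | succ n ih =>
    refine ⟨?_, fun k hk => ?_⟩
    · rw [connPoly, coeff_sub, coeff_smul, ih.2 _ (Nat.lt_succ_self n), laguerre_one_coeff]
      simp
    · rw [connPoly, coeff_sub, coeff_smul, ih.2 k (by omega), laguerre_one_coeff,
        Nat.choose_eq_zero_of_lt (by omega)]
      simp

/-! ### Identification with Gram–Schmidt and uniqueness of the coefficients. -/

/-- Expansion of a polynomial in an orthogonal sequence of monic polynomials. -/
lemma eq_sum_of_orthogonal (B : LinearMap.BilinForm ℝ ℝ[X]) (Q : ℕ → ℝ[X])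
    (hQ : ∀ n, (Q n).coeff n = 1 ∧ ∀ k, n < k → (Q n).coeff k = 0)
    (hort : ∀ m n, m < n → B (Q n) (Q m) = 0) (hne : ∀ n, B (Q n) (Q n) ≠ 0)
    (hort' : ∀ m n, m < n → B (Q m) (Q n) = 0) (n : ℕ) (p : ℝ[X])
    (hp : ∀ k, n ≤ k → p.coeff k = 0) :
    p = ∑ k ∈ Finset.range n, C (B p (Q k) / B (Q k) (Q k)) * Q k := by
  induction n generalizing p with
  | zero => ext k; simpa using hp k (Nat.zero_le k)
  | succ n ih =>
    have hr := ih (p - p.coeff n • Q n) fun k hk => by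
      rw [coeff_sub, coeff_smul, smul_eq_mul]
      rcases hk.lt_or_eq with hk | rfl
      · rw [hp k hk, (hQ n).2 k hk]; simp
      · rw [(hQ n).1]; simp
    have hB : ∀ k < n, B (p - p.coeff n • Q n) (Q k) = B p (Q k) := fun k hk => by
      rw [map_sub, map_smul, LinearMap.sub_apply, LinearMap.smul_apply, hort k n hk]; simp
    rw [Finset.sum_congr rfl fun k hk => by rw [hB k (Finset.mem_range.1 hk)]] at hr
    have hn : B p (Q n) = p.coeff n * B (Q n) (Q n) := by
      conv_lhs => rw [sub_eq_iff_eq_add.1 hr]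
      rw [map_add, map_sum, LinearMap.add_apply, LinearMap.sum_apply, map_smul,
        LinearMap.smul_apply, smul_eq_mul, Finset.sum_eq_zero, zero_add]
      intro k hk
      rw [← smul_eq_C_mul, map_smul, LinearMap.smul_apply, hort' k n (Finset.mem_range.1 hk)]
      simp
    rw [Finset.sum_range_succ, ← hr, hn, mul_div_cancel_right₀ _ (hne n), smul_eq_C_mul]
    ring

/-- The Gram-Schmidt polynomials are the unique monic orthogonal sequence. -/
lemma gramSchmidtPoly_eq_of_orthogonal (lam : ℝ) (Q : ℕ → ℝ[X])
    (hQ : ∀ n, (Q n).coeff n = 1 ∧ ∀ k, n < k → (Q n).coeff k = 0)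
    (hort : ∀ m n, m < n → polyForm lam (Q n) (Q m) = 0)
    (hne : ∀ n, polyForm lam (Q n) (Q n) ≠ 0) (n : ℕ) :
    gramSchmidtPoly lam n = Q n := by
  induction n using Nat.strong_induction_on with
  | _ n ih =>
    have hort' : ∀ m n, m < n → polyForm lam (Q m) (Q n) = 0 := fun m n h => by
      rw [polyForm_comm, hort m n h]
    have h := eq_sum_of_orthogonal (polyForm lam) Q hQ hort hne hort' n (X ^ n - Q n)
      fun k hk => by
        rw [coeff_sub, coeff_X_pow]
        rcases hk.lt_or_eq with hk | rfl
        · rw [(hQ n).2 k hk, if_neg hk.ne']; simp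
        · rw [(hQ n).1]; simp
    rw [gramSchmidtPoly, Fin.sum_univ_eq_sum_range (fun k =>
      C (polyInner lam (X ^ n) (gramSchmidtPoly lam k) /
        polyInner lam (gramSchmidtPoly lam k) (gramSchmidtPoly lam k)) *
      gramSchmidtPoly lam k), sub_eq_iff_eq_add, ← sub_eq_iff_eq_add', h]
    refine Finset.sum_congr rfl fun k hk => ?_
    have hk := Finset.mem_range.1 hk
    rw [ih k hk, polyInner_eq_polyForm, polyInner_eq_polyForm, map_sub, LinearMap.sub_apply,
      hort k n hk, sub_zero]

lemma sobolevPoly_eq_connPoly {lam : ℝ} (hlam : 0 < lam) (n : ℕ) :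
    sobolevPoly lam n = connPoly lam n := by
  have hc : ∀ n : ℕ, (n.factorial : ℝ) * (-1) ^ n ≠ 0 := fun n => by
    have : (n.factorial : ℝ) ≠ 0 := by positivity
    simp [this]
  rw [sobolevPoly, gramSchmidtPoly_eq_of_orthogonal lam
    (fun n => ((n.factorial : ℝ) * (-1) ^ n) • connPoly lam n)]
  · rw [← smul_eq_C_mul, smul_smul]
    have h1 : (n.factorial : ℝ) ≠ 0 := by positivity
    have h2 : (-1 : ℝ) ^ n * (-1) ^ n = 1 := by rw [← mul_pow]; simp
    rw [show (-1 : ℝ) ^ n / n.factorial * (n.factorial * (-1) ^ n) = 1 by field_simp; linarith,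
      one_smul]
  · intro n
    refine ⟨?_, fun k hk => ?_⟩
    · rw [coeff_smul, (connPoly_coeff lam n).1, smul_eq_mul]
      have h1 : (n.factorial : ℝ) ≠ 0 := by positivity
      have h2 : (-1 : ℝ) ^ n * (-1) ^ n = 1 := by rw [← mul_pow]; simp
      field_simp
      linarith
    · rw [coeff_smul, (connPoly_coeff lam n).2 k hk, smul_zero]
  · intro m n h
    simp only [map_smul, LinearMap.smul_apply, polyForm_connPoly_of_lt hlam h, smul_zero]
  · intro n
    simp only [map_smul, LinearMap.smul_apply, polyForm_connPoly_self hlam, smul_eq_mul]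
    exact mul_ne_zero (hc n) (mul_ne_zero (hc n) (connNorm_pos hlam n).ne')

lemma isConnectionSeq_iff {lam : ℝ} (hlam : 0 < lam) (a : ℕ → ℝ) :
    IsConnectionSeq lam a ↔ a = connCoeff lam := by
  constructor
  · intro h
    funext n
    have h1 := h n
    rw [sobolevPoly_eq_connPoly hlam, sobolevPoly_eq_connPoly hlam, connPoly,
      ← smul_eq_C_mul] at h1
    -- The coefficient of degree `n` isolates `a n`, since `connPoly lam n` has exact degree `n`.
    have h2 := congrArg (fun p => p.coeff n) h1
    simp only [coeff_add, coeff_sub, coeff_smul, smul_eq_mul] at h2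
    have h3 : (connPoly lam n).coeff n ≠ 0 := by
      rw [(connPoly_coeff lam n).1]
      have : (n.factorial : ℝ) ≠ 0 := by positivity
      simp [this]
    apply mul_right_cancel₀ h3
    linarith
  · rintro rfl n
    rw [sobolevPoly_eq_connPoly hlam, sobolevPoly_eq_connPoly hlam, connPoly, ← smul_eq_C_mul]
    abel

/-! ### Asymptotics of the ratio recursion. -/

lemma inv_sub_inv_bounds {r r' : ℝ} (hr : 1 ≤ r) (hr' : 0 < r') (h : r' ^ 2 = r ^ 2 + 1) :
    0 ≤ 1 / r - 1 / r' ∧ 1 / r - 1 / r' ≤ 1 / r ^ 3 := by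
  have h0 : 0 < r := by linarith
  have hlt : r ≤ r' := by nlinarith
  refine ⟨sub_nonneg.2 (one_div_le_one_div_of_le h0 hlt), ?_⟩
  have hd : r' - r ≤ 1 / r := by
    rw [le_div_iff₀ h0]; nlinarith
  calc 1 / r - 1 / r' = (r' - r) / (r * r') := by field_simp
    _ ≤ (1 / r) / (r * r) := by gcongr
    _ = 1 / r ^ 3 := by field_simp

/-- One step of the recursion `y ↦ s² / m + y / (1 + y)` keeps `y` within `K / m` of `s / √m`,
where `m = r ^ 2`. -/
lemma abs_recursion_step_le {s r r' y K : ℝ} (hs : 0 < s) (hr : 1 ≤ r) (hr' : 0 < r')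
    (h : r' ^ 2 = r ^ 2 + 1) (hsr : 2 ≤ s * r) (hy : 0 < y)
    (hK : 4 * (s ^ 3 + s) * (1 + s) / s ≤ K) (hyK : |y - s / r| ≤ K / r ^ 2) :
    |s ^ 2 / r ^ 2 + y / (1 + y) - s / r'| ≤ K / r' ^ 2 := by
  have h0 : 0 < r := by linarith
  have hK0 : 0 < K := lt_of_lt_of_le (by positivity) hK
  obtain ⟨hb1, hb2⟩ := inv_sub_inv_bounds hr hr' h
  have hg : 0 < s / r := by positivity
  -- With `g = s / r`: `y/(1+y) - g/(1+g) = (y-g)/((1+y)(1+g))` is the propagated error, and `g² +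
  -- g/(1+g) - g = g³/(1+g)` the defect of the equilibrium.
  have e : s ^ 2 / r ^ 2 + y / (1 + y) - s / r' =
      (y - s / r) / ((1 + y) * (1 + s / r)) + ((s / r) ^ 3 / (1 + s / r) +
        s * (1 / r - 1 / r')) := by
    rw [← div_pow, show s / r' = s / r - s * (1 / r - 1 / r') by ring]
    generalize s / r = g at *
    field_simp
    ring
  have h1 : |(y - s / r) / ((1 + y) * (1 + s / r))| ≤ K / (r ^ 2 * (1 + s / r)) := by
    rw [abs_div, abs_of_pos (show 0 < (1 + y) * (1 + s / r) by positivity), ← div_div,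
      ← div_div K]
    gcongr ?_ / _
    exact (div_le_self (abs_nonneg _) (by linarith)).trans hyK
  have h2 : |(s / r) ^ 3 / (1 + s / r) + s * (1 / r - 1 / r')| ≤ (s ^ 3 + s) / r ^ 3 := by
    rw [abs_of_nonneg (by positivity)]
    have h3 : (s / r) ^ 3 / (1 + s / r) ≤ (s / r) ^ 3 :=
      div_le_self (by positivity) (by linarith)
    have h4 : s * (1 / r - 1 / r') ≤ s * (1 / r ^ 3) := by gcongr
    calc _ ≤ (s / r) ^ 3 + s * (1 / r ^ 3) := add_le_add h3 h4
      _ = _ := by field_simp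
  -- The contraction by `1 + s / r` outweighs the shrinking of the target from `K / r²` to `K / (r²
  -- + 1)`. The surplus has numerator `K (s r - 1)`, at least `K s r / 2` as `s r ≥ 2`, and absorbs
  -- the defect by the choice of `K`.
  have h5 : (s ^ 3 + s) / r ^ 3 ≤ K / (r ^ 2 + 1) - K / (r ^ 2 * (1 + s / r)) := by
    have hKs : s ^ 3 + s ≤ K * s / (4 * (1 + s)) := by
      rw [div_le_iff₀ hs] at hK
      rw [le_div_iff₀ (by positivity)]
      linarith
    have hr2 : r ≤ r ^ 2 := by nlinarith
    calc (s ^ 3 + s) / r ^ 3 ≤ K * s / (4 * (1 + s)) / r ^ 3 := by gcongr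
      _ = K * (s * r / 2) / ((r ^ 2 + r ^ 2) * (r ^ 2 + s * r ^ 2)) := by field_simp; ring
      _ ≤ K * (s * r - 1) / ((r ^ 2 + 1) * (r ^ 2 + s * r)) := by
          gcongr
          · exact mul_nonneg hK0.le (by linarith)
          · linarith
          · linarith
      _ = K / (r ^ 2 + 1) - K / (r ^ 2 * (1 + s / r)) := by
          have : r ^ 2 * (1 + s / r) = r ^ 2 + s * r := by field_simp
          rw [this]
          field_simp
          ring
  rw [e, h]
  refine (abs_add_le _ _).trans ?_
  linarith

lemma exists_abs_recursion_sub_le {s : ℝ} (hs : 0 < s) {y : ℕ → ℝ} (hy : ∀ n, 0 < y n)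
    (hrec : ∀ n : ℕ, y (n + 1) = s ^ 2 / ((n : ℝ) + 2) + y n / (1 + y n)) :
    ∃ K : ℝ, 0 ≤ K ∧ ∀ᶠ n : ℕ in atTop, |y n - s / √((n : ℝ) + 2)| ≤ K / ((n : ℝ) + 2) := by
  -- From `N` on, `s √(n+2) ≥ 2`; the second entry of the maximum defining `K` settles the base
  -- case.
  obtain ⟨N, hN⟩ := exists_nat_ge ((2 / s) ^ 2)
  set K := max (4 * (s ^ 3 + s) * (1 + s) / s) (|y N - s / √((N : ℝ) + 2)| * ((N : ℝ) + 2)) with hK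
  refine ⟨K, le_max_of_le_left (by positivity), eventually_atTop.2 ⟨N, fun n hn => ?_⟩⟩
  induction n, hn using Nat.le_induction with
  | base =>
    rw [le_div_iff₀ (by positivity)]
    exact le_max_right _ _
  | succ n hn ih =>
    have hsq : √((n : ℝ) + 2) ^ 2 = (n : ℝ) + 2 := Real.sq_sqrt (by positivity)
    have hsq' : √(((n + 1 : ℕ) : ℝ) + 2) ^ 2 = ((n + 1 : ℕ) : ℝ) + 2 :=
      Real.sq_sqrt (by positivity)
    have hr : 1 ≤ √((n : ℝ) + 2) := Real.one_le_sqrt.2 (by linarith [n.cast_nonneg (α := ℝ)])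
    have hn' : (N : ℝ) ≤ n := by exact_mod_cast hn
    have hsr : 2 / s ≤ √((n : ℝ) + 2) := Real.le_sqrt_of_sq_le (by linarith)
    rw [div_le_iff₀' hs] at hsr
    have := abs_recursion_step_le hs hr (r' := √(((n + 1 : ℕ) : ℝ) + 2)) (by positivity)
      (by rw [hsq, hsq']; push_cast; ring) hsr (hy n) (le_max_left _ _) (by rw [hsq]; exact ih)
    rwa [hsq, hsq', ← hrec] at this

lemma isBigO_inv_one_add_recursion {s : ℝ} (hs : 0 < s) {y : ℕ → ℝ} (hy : ∀ n, 0 < y n)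
    (hrec : ∀ n : ℕ, y (n + 1) = s ^ 2 / ((n : ℝ) + 2) + y n / (1 + y n)) :
    (fun n : ℕ => ((n : ℝ) + 2) / (n + 1) * (1 / (1 + y n)) - (1 - s / √(n : ℝ)))
      =O[atTop] fun n : ℕ => 1 / (n : ℝ) := by
  obtain ⟨K, hK0, hK⟩ := exists_abs_recursion_sub_le hs hy hrec
  refine IsBigO.of_bound ((s + K) ^ 2 + 1 + (2 * s + K)) ?_
  filter_upwards [hK, eventually_ge_atTop 1] with n hn hn1
  have hn1 : (1 : ℝ) ≤ n := by exact_mod_cast hn1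
  have hn0 : (0 : ℝ) < n := by linarith
  have hr1 : 1 ≤ √(n : ℝ) := Real.one_le_sqrt.2 hn1
  have hr0 : 0 < √(n : ℝ) := by linarith
  have hrr : √(n : ℝ) ≤ √((n : ℝ) + 2) := Real.sqrt_le_sqrt (by linarith)
  have hsq : √(n : ℝ) ^ 2 = n := Real.sq_sqrt hn0.le
  have hsq2 : √((n : ℝ) + 2) ^ 2 = n + 2 := Real.sq_sqrt (by linarith)
  have hy0 := hy n
  have hyle : y n ≤ (s + K) / √(n : ℝ) := by
    have h1 : s / √((n : ℝ) + 2) ≤ s / √(n : ℝ) := by gcongr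
    have h2 : K / ((n : ℝ) + 2) ≤ K / √(n : ℝ) := by
      gcongr
      nlinarith
    rw [add_div]
    linarith [(abs_le.1 hn).2]
  have hysq : y n ^ 2 ≤ (s + K) ^ 2 / n := by
    calc y n ^ 2 ≤ ((s + K) / √(n : ℝ)) ^ 2 := by gcongr
      _ = _ := by rw [div_pow, hsq]
  have hdiff : |s / √(n : ℝ) - s / √((n : ℝ) + 2)| ≤ 2 * s / n := by
    have h1 : s / √((n : ℝ) + 2) ≤ s / √(n : ℝ) := by gcongr
    rw [abs_of_nonneg (by linarith)]
    calc s / √(n : ℝ) - s / √((n : ℝ) + 2)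
        = s * (√((n : ℝ) + 2) - √(n : ℝ)) / (√(n : ℝ) * √((n : ℝ) + 2)) := by
          field_simp
      _ ≤ s * 2 / (√(n : ℝ) * √(n : ℝ)) := by
          gcongr
          nlinarith
      _ = 2 * s / n := by rw [← sq, hsq]; ring
  -- Uses `1/(1+y) = 1 - y + y²/(1+y)` and `(n+2)/(n+1) = 1 + 1/(n+1)`; each remaining term is
  -- `O(1/n)`.
  have e : ((n : ℝ) + 2) / (n + 1) * (1 / (1 + y n)) - (1 - s / √(n : ℝ)) =
      y n ^ 2 / (1 + y n) + 1 / (n + 1) / (1 + y n) +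
        ((s / √(n : ℝ) - s / √((n : ℝ) + 2)) - (y n - s / √((n : ℝ) + 2))) := by
    generalize s / √(n : ℝ) = g
    field_simp
    ring
  have h1 : |y n ^ 2 / (1 + y n)| ≤ (s + K) ^ 2 / n := by
    rw [abs_of_nonneg (by positivity)]
    exact (div_le_self (by positivity) (by linarith)).trans hysq
  have h2 : |1 / ((n : ℝ) + 1) / (1 + y n)| ≤ 1 / n := by
    rw [abs_of_nonneg (by positivity)]
    refine (div_le_self (by positivity) (by linarith)).trans ?_
    gcongr
    linarith
  have h3 : |y n - s / √((n : ℝ) + 2)| ≤ K / n := by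
    refine hn.trans ?_
    gcongr
    linarith
  rw [e, Real.norm_eq_abs, Real.norm_eq_abs, abs_of_pos (by positivity : (0 : ℝ) < 1 / n)]
  calc _ ≤ (s + K) ^ 2 / n + 1 / n + (2 * s / n + K / n) :=
        (abs_add_le _ _).trans (add_le_add ((abs_add_le _ _).trans (add_le_add h1 h2))
          ((abs_sub _ _).trans (add_le_add hdiff h3)))
    _ = _ := by ring

lemma connCoeff_isBigO {lam : ℝ} (hlam : 0 < lam) :
    (fun n : ℕ => connCoeff lam n - (1 - √(4 * lam) / √(n : ℝ)))
      =O[atTop] fun n : ℕ => 1 / (n : ℝ) := by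
  have hs : 0 < √(4 * lam) := by positivity
  have hs2 : √(4 * lam) ^ 2 = 4 * lam := Real.sq_sqrt (by positivity)
  set y : ℕ → ℝ := fun n =>
    (laguerre 1 (n + 1)).eval (-4 * lam) / (laguerre 1 n).eval (-4 * lam) - 1 with hy
  have hrec : ∀ n : ℕ, y (n + 1) = √(4 * lam) ^ 2 / ((n : ℝ) + 2) + y n / (1 + y n) := by
    intro n
    have h0 := (laguerre_one_eval_pos n hlam).ne'
    have h1 := (laguerre_one_eval_pos (n + 1) hlam).ne'
    have h := laguerre_one_eval_recurrence n (-4 * lam)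
    simp only [hy, hs2, add_sub_cancel]
    rw [show n + 1 + 1 = n + 2 from rfl]
    generalize eval (-4 * lam) (laguerre 1 n) = u at *
    generalize eval (-4 * lam) (laguerre 1 (n + 1)) = v at *
    generalize eval (-4 * lam) (laguerre 1 (n + 2)) = w at *
    field_simp
    linear_combination h
  have hpos : ∀ n, 0 < y n := by
    intro n
    induction n with
    | zero =>
      simp only [hy, zero_add, laguerre_one_zero, laguerre_one_one, eval_sub, eval_X, eval_one,
        eval_ofNat]
      linarith
    | succ n ih => rw [hrec]; positivity
  have h := isBigO_inv_one_add_recursion hs hpos hrec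
  simpa only [hy, add_sub_cancel, one_div_div, connCoeff] using h

end LaguerreSobolev

end

theorem mainTheorem3 (lam : ℝ) (hlam : 0 < lam) :
    (∃! a : ℕ → ℝ, LaguerreSobolev.IsConnectionSeq lam a) ∧
    ∀ a : ℕ → ℝ, LaguerreSobolev.IsConnectionSeq lam a →
      (∀ n : ℕ,
        (LaguerreSobolev.laguerre 1 (n + 1)).eval (-4 * lam) ≠ 0 ∧
        a n = (((n : ℝ) + 2) / ((n : ℝ) + 1)) *
          ((LaguerreSobolev.laguerre 1 n).eval (-4 * lam) /
            (LaguerreSobolev.laguerre 1 (n + 1)).eval (-4 * lam))) ∧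
      (fun n : ℕ => a n - (1 - Real.sqrt (4 * lam) / Real.sqrt (n : ℝ)))
        =O[atTop] (fun n : ℕ => 1 / (n : ℝ)) := by
  simp only [LaguerreSobolev.isConnectionSeq_iff hlam]
  refine ⟨⟨_, rfl, fun _ h => h⟩, ?_⟩
  rintro a rfl
  exact ⟨fun n => ⟨(LaguerreSobolev.laguerre_one_eval_pos (n + 1) hlam).ne', rfl⟩,
    LaguerreSobolev.connCoeff_isBigO hlam⟩
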